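/- Let $F$ be a free group, and let $H$ and $K$ be nontrivial finitely generated subgroups of $F$, of ranks $h$ and $k$ respectively. Let $H\vee K=\langle H,K\rangle$ denote the subgroup of $F$ generated by $H\cup K$. If \[ \mathrm{rank}(H\vee K)-1\ \ge\ \frac{h+k-1}{2}, \] then $H\cap K$ is finitely generated and \[ \mathrm{rank}(H\cap K)-1\ \le\ (h-1)(k-1). \] -/

import Mathlib

/-- The join of two finitely generated subgroups is finitely generated, so that its rank
`Group.rank` (the least number of generators) makes sense. -/
instance joinFG {F : Type*} [Group F] (H K : Subgroup F) [hH : Group.FG H] [hK : Group.FG K] :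
    Group.FG (H ⊔ K : Subgroup F) :=
  (Group.fg_iff_subgroup_fg _).2
    (((Group.fg_iff_subgroup_fg H).1 hH).sup ((Group.fg_iff_subgroup_fg K).1 hK))

/-! The method is Mineyev's. Free groups are left-orderable, so the vertices and edges of the Cayley
tree carry translation-invariant linear orders. A finitely generated `H ≠ ⊥` acts freely and
cocompactly on a subtree `X`, and the essential edges of `X` form exactly `rank H - 1` orbits.

Indeed, an inessential edge absorbs a finite component of the graph of smaller edges, and the least
vertex of that component loses. This matches inessential edges with vertices, injectively both ways
and equivariantly. No vertex is left over: it would stay least in arbitrarily large finite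
components, one of which would contain two vertices of one orbit, against freeness. So inessential
edge orbits cancel vertex orbits in the Euler characteristic (`card_edge_orbits_le`,
`card_vertex_orbits_add_le`, `finrank_hom_add_card`).

Components only grow with the graph, so an edge essential in `X ∩ Y` is essential in `X` and in `Y`.
Orbits under `H ⊓ K` inject into pairs of orbits, which yields the product bound
(`essentialCount_inter_le`).

Trees enter through linear algebra over `ℚ`: `hpot` expresses that there are no cycles, `hconn`
connectedness, and the rank of a free group is the dimension of its homomorphisms to `ℚ`. -/

namespace EdgeOrder

open Set

/-! ### Components of smaller edges and the vertices that lose -/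

section Clusters

variable {V E : Type*} [LinearOrder E] (s t : E → V)

/-- `x` and `y` are joined by a path all of whose edges are smaller than `e`. -/
def Below (e : E) : V → V → Prop :=
  Relation.EqvGen fun x y => ∃ d < e, s d = x ∧ t d = y

/-- The component of `x` in the graph of all edges smaller than `e`. -/
def cluster (e : E) (x : V) : Set V := {y | Below s t e x y}

/-- An edge is essential if both of its ends lie in infinite components of the graph of
smaller edges. -/
def IsEssential (e : E) : Prop :=
  (cluster s t e (s e)).Infinite ∧ (cluster s t e (t e)).Infinite

variable {s t}

lemma Below.refl (e : E) (x : V) : Below s t e x x := Relation.EqvGen.refl x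

lemma Below.symm {e : E} {x y : V} (h : Below s t e x y) : Below s t e y x :=
  Relation.EqvGen.symm _ _ h

lemma Below.trans {e : E} {x y z : V} (h : Below s t e x y) (h' : Below s t e y z) :
    Below s t e x z :=
  Relation.EqvGen.trans _ _ _ h h'

lemma Below.of_lt {d e : E} (h : d < e) : Below s t e (s d) (t d) :=
  Relation.EqvGen.rel _ _ ⟨d, h, rfl, rfl⟩

lemma Below.mono {d e : E} (h : d ≤ e) {x y : V} (hxy : Below s t d x y) : Below s t e x y :=
  Relation.EqvGen.mono (fun _ _ ⟨c, hc, hc'⟩ => ⟨c, hc.trans_le h, hc'⟩) _ _ hxy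

lemma mem_cluster_self (e : E) (x : V) : x ∈ cluster s t e x := Below.refl e x

lemma cluster_eq {e : E} {x y : V} (h : Below s t e x y) : cluster s t e x = cluster s t e y :=
  Set.ext fun _ => ⟨fun hz => h.symm.trans hz, fun hz => h.trans hz⟩

lemma cluster_mono {d e : E} (h : d ≤ e) (x : V) : cluster s t d x ⊆ cluster s t e x :=
  fun _ hy => Below.mono h hy

/-- A set that no edge smaller than `e` leaves is a union of components of the graph of edges
smaller than `e`. -/
lemma Below.mem_iff {e : E} {M : Set V} (hM : ∀ d < e, (s d ∈ M ↔ t d ∈ M)) {x y : V}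
    (h : Below s t e x y) : x ∈ M ↔ y ∈ M := by
  induction h with
  | rel x y h => obtain ⟨d, hd, rfl, rfl⟩ := h; exact hM d hd
  | refl => rfl
  | symm _ _ _ ih => exact ih.symm
  | trans _ _ _ _ _ ih₁ ih₂ => exact ih₁.trans ih₂

lemma Below.eq_of_potential {e : E} {f : V → ℚ} (hf : ∀ d < e, f (t d) = f (s d)) {x y : V}
    (h : Below s t e x y) : f x = f y := by
  induction h with
  | rel x y h => obtain ⟨d, hd, rfl, rfl⟩ := h; exact (hf d hd).symm
  | refl => rfl
  | symm _ _ _ ih => exact ih.symm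
  | trans _ _ _ _ _ ih₁ ih₂ => exact ih₁.trans ih₂

/-- A potential that jumps only across `e` is constant on components of smaller edges, yet differs
at the two ends of `e`. -/
lemma not_below_ends (hpot : ∀ c : E → ℚ, ∃ f : V → ℚ, ∀ e, f (t e) - f (s e) = c e) (e : E) :
    ¬ Below s t e (s e) (t e) := by
  intro h
  obtain ⟨f, hf⟩ := hpot (Pi.single e 1)
  have h₁ := h.eq_of_potential (f := f) fun d hd => by
    have := hf d
    rw [Pi.single_eq_of_ne hd.ne] at this
    linarith
  have h₂ := hf e
  rw [Pi.single_eq_same] at h₂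
  linarith

variable [LinearOrder V]

/-- Adding the edge `e` to the graph of smaller edges merges the finite component with least vertex
`v` into a component that is infinite or has a smaller least vertex. -/
def Loses (s t : E → V) (e : E) (v : V) : Prop :=
  (cluster s t e v).Finite ∧ (∀ y ∈ cluster s t e v, v ≤ y) ∧
    ((Below s t e v (s e) ∧
        ((cluster s t e (t e)).Infinite ∨ ∃ y ∈ cluster s t e (t e), y < v)) ∨
      (Below s t e v (t e) ∧
        ((cluster s t e (s e)).Infinite ∨ ∃ y ∈ cluster s t e (s e), y < v)))

lemma Loses.not_isEssential {e : E} {v : V} (h : Loses s t e v) : ¬ IsEssential s t e := by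
  rintro ⟨h₁, h₂⟩
  obtain ⟨hf, -, ⟨hb, -⟩ | ⟨hb, -⟩⟩ := h
  · exact h₁ (cluster_eq hb ▸ hf)
  · exact h₂ (cluster_eq hb ▸ hf)

/-- Below any larger edge, `e` has already joined `v` to an infinite component or to a vertex
smaller than `v`. -/
lemma Loses.not_lt {e d : E} {v : V} (h : Loses s t e v) (h' : Loses s t d v) : ¬ e < d := by
  intro hlt
  have key : ∀ x y, Below s t e v x → Below s t d x y →
      ((cluster s t e y).Infinite ∨ ∃ z ∈ cluster s t e y, z < v) → False := by
    intro x y hvx hxy hy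
    have hvy : Below s t d v y := (hvx.mono hlt.le).trans hxy
    have hsub : cluster s t e y ⊆ cluster s t d v := by
      rw [cluster_eq hvy]; exact cluster_mono hlt.le y
    rcases hy with hy | ⟨z, hz, hzv⟩
    · exact hy (h'.1.subset hsub)
    · exact absurd (h'.2.1 z (hsub hz)) (not_le.2 hzv)
  obtain ⟨-, -, ⟨hb, hc⟩ | ⟨hb, hc⟩⟩ := h
  · exact key _ _ hb (Below.of_lt hlt) hc
  · exact key _ _ hb (Below.of_lt hlt).symm hc

lemma Loses.edge_unique {e d : E} {v : V} (h : Loses s t e v) (h' : Loses s t d v) : e = d :=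
  le_antisymm (_root_.not_lt.1 (Loses.not_lt h' h)) (_root_.not_lt.1 (Loses.not_lt h h'))

/-- Two losers in the same component are both its minimum; in opposite components each would be
smaller than the other. -/
lemma Loses.vertex_unique {e : E} {v w : V} (h : Loses s t e v) (h' : Loses s t e w) : v = w := by
  have same : ∀ x, Below s t e v x → Below s t e w x → v = w := fun x hv hw =>
    le_antisymm (h.2.1 w (hv.trans hw.symm)) (h'.2.1 v (hw.trans hv.symm))
  have diff : ∀ {v w : V} {x y : V}, Loses s t e v → Loses s t e w → Below s t e v x →
      Below s t e w y →
      ((cluster s t e y).Infinite ∨ ∃ z ∈ cluster s t e y, z < v) → w < v := by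
    intro v w x y hv hw _ hwy hy
    rw [← cluster_eq hwy] at hy
    rcases hy with hy | ⟨z, hz, hzv⟩
    · exact absurd hw.1 hy
    · exact (hw.2.1 z hz).trans_lt hzv
  rcases h.2.2 with ⟨hb, hc⟩ | ⟨hb, hc⟩ <;> rcases h'.2.2 with ⟨hb', hc'⟩ | ⟨hb', hc'⟩
  · exact same _ hb hb'
  · exact absurd (diff h h' hb hb' hc) (diff h' h hb' hb hc').asymm
  · exact absurd (diff h h' hb hb' hc) (diff h' h hb' hb hc').asymm
  · exact same _ hb hb'

lemma exists_min_cluster {e : E} {x : V} (h : (cluster s t e x).Finite) :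
    ∃ v, Below s t e v x ∧ ∀ y ∈ cluster s t e v, v ≤ y := by
  obtain ⟨v, hv, hmin⟩ := h.exists_minimalFor id _ ⟨x, mem_cluster_self e x⟩
  refine ⟨v, Below.symm hv, fun y hy => ?_⟩
  rw [← cluster_eq hv] at hy
  exact (le_total v y).elim id fun h => hmin hy h

/-- In a forest every inessential edge makes some vertex lose. -/
lemma exists_loses (hpot : ∀ c : E → ℚ, ∃ f : V → ℚ, ∀ e, f (t e) - f (s e) = c e) {e : E}
    (he : ¬ IsEssential s t e) : ∃ v, Loses s t e v := by
  by_cases hs : (cluster s t e (s e)).Infinite <;> by_cases ht : (cluster s t e (t e)).Infinite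
  · exact absurd ⟨hs, ht⟩ he
  · rw [Set.not_infinite] at ht
    obtain ⟨v, hv, hmin⟩ := exists_min_cluster ht
    exact ⟨v, cluster_eq hv ▸ ht, hmin, Or.inr ⟨hv, Or.inl hs⟩⟩
  · rw [Set.not_infinite] at hs
    obtain ⟨v, hv, hmin⟩ := exists_min_cluster hs
    exact ⟨v, cluster_eq hv ▸ hs, hmin, Or.inl ⟨hv, Or.inl ht⟩⟩
  · rw [Set.not_infinite] at hs ht
    obtain ⟨v, hv, hvmin⟩ := exists_min_cluster hs
    obtain ⟨w, hw, hwmin⟩ := exists_min_cluster ht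
    rcases lt_trichotomy v w with h | rfl | h
    · exact ⟨w, cluster_eq hw ▸ ht, hwmin, Or.inr ⟨hw, Or.inr ⟨v, hv.symm, h⟩⟩⟩
    · exact absurd (hv.symm.trans hw) (not_below_ends hpot e)
    · exact ⟨v, cluster_eq hv ▸ hs, hvmin, Or.inl ⟨hv, Or.inr ⟨w, hw.symm, h⟩⟩⟩

/-- The edge `e` leaves the finite component of `v` below `e`, whose least vertex is `v`. -/
def Exits (s t : E → V) (v : V) (e : E) : Prop :=
  (cluster s t e v).Finite ∧ (∀ y ∈ cluster s t e v, v ≤ y) ∧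
    (Below s t e v (s e) ∧ ¬ Below s t e v (t e) ∨ Below s t e v (t e) ∧ ¬ Below s t e v (s e))

/-- A finite set with least vertex `v` that is connected by edges smaller than all edges leaving it
is the component of `v` below the smallest edge leaving it. -/
lemma exists_exits [Infinite V]
    (hconn : ∀ f : V → ℚ, (∀ e, f (t e) = f (s e)) → ∀ x y, f x = f y)
    (hloc : ∀ x, {e | s e = x ∨ t e = x}.Finite) {v : V} {M : Set V} (hM : M.Finite) (hv : v ∈ M)
    (hmin : ∀ y ∈ M, v ≤ y)
    (hbelow : ∀ e, ¬ (s e ∈ M ↔ t e ∈ M) → ∀ y ∈ M, Below s t e v y) :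
    ∃ e, ¬ (s e ∈ M ↔ t e ∈ M) ∧ Exits s t v e ∧ cluster s t e v = M := by
  classical
  have hfin : {e | ¬ (s e ∈ M ↔ t e ∈ M)}.Finite := by
    refine (hM.biUnion fun x _ => hloc x).subset fun e he => ?_
    simp only [mem_ofPred_eq, mem_iUnion] at he ⊢
    by_cases h : s e ∈ M
    · exact ⟨_, h, Or.inl rfl⟩
    · exact ⟨t e, by tauto, Or.inr rfl⟩
  have hne : {e | ¬ (s e ∈ M ↔ t e ∈ M)}.Nonempty := by
    by_contra hcon
    rw [Set.not_nonempty_iff_eq_empty, Set.eq_empty_iff_forall_notMem] at hcon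
    obtain ⟨w, hw⟩ := hM.infinite_compl.nonempty
    have := hconn (fun x => if x ∈ M then 1 else 0) (fun e => by
      have := hcon e
      simp only [mem_ofPred_eq, not_not] at this
      simp [this]) v w
    simp [hv, show w ∉ M from hw] at this
  -- Edges below the smallest leaving edge do not cross the boundary of `M`, so they keep the
  -- component of `v` inside `M`.
  obtain ⟨e, he, hemin⟩ := hfin.exists_minimalFor id _ hne
  have hcl : cluster s t e v = M := by
    refine Set.ext fun y => ⟨fun hy => ?_, fun hy => hbelow e he y hy⟩
    refine (Below.mem_iff (fun d hd => ?_) hy).1 hv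
    by_contra hd'
    exact absurd (hemin (j := d) hd' hd.le) (not_le.2 hd)
  refine ⟨e, he, ⟨hcl ▸ hM, hcl ▸ hmin, ?_⟩, hcl⟩
  have h₁ : ∀ y, Below s t e v y ↔ y ∈ M := fun y => Set.ext_iff.1 hcl y
  rw [h₁, h₁]
  have : ¬ (s e ∈ M ↔ t e ∈ M) := he
  tauto

lemma exists_first_exit [Infinite V]
    (hconn : ∀ f : V → ℚ, (∀ e, f (t e) = f (s e)) → ∀ x y, f x = f y)
    (hloc : ∀ x, {e | s e = x ∨ t e = x}.Finite) (v : V) : ∃ e, Exits s t v e := by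
  obtain ⟨e, -, he, -⟩ := exists_exits hconn hloc (M := {v}) (Set.finite_singleton v) rfl
    (fun y hy => (mem_singleton_iff.1 hy).ge)
    (fun e _ y hy => (mem_singleton_iff.1 hy).symm ▸ Below.refl e v)
  exact ⟨e, he⟩

/-- A vertex that never loses stays the least vertex of ever larger finite components. -/
lemma exists_next_exit [Infinite V]
    (hconn : ∀ f : V → ℚ, (∀ e, f (t e) = f (s e)) → ∀ x y, f x = f y)
    (hloc : ∀ x, {e | s e = x ∨ t e = x}.Finite) {v : V} (hv : ∀ e, ¬ Loses s t e v) {e : E}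
    (he : Exits s t v e) : ∃ d, Exits s t v d ∧ cluster s t e v ⊂ cluster s t d v := by
  obtain ⟨hfin, hmin, hends⟩ := he
  -- Here `x` is the end of `e` in the component of `v`, and `y` the other end. As `v` does not
  -- lose, the component of `y` is finite with no vertex below `v`.
  obtain ⟨x, y, hx, hy, hxy, hyfin, hymin, hse, hte⟩ : ∃ x y, Below s t e v x ∧ ¬ Below s t e v y ∧
      (∀ d, e < d → Below s t d x y) ∧ (cluster s t e y).Finite ∧
      (∀ z ∈ cluster s t e y, v ≤ z) ∧ s e ∈ cluster s t e v ∪ cluster s t e y ∧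
      t e ∈ cluster s t e v ∪ cluster s t e y := by
    rcases hends with ⟨h₁, h₂⟩ | ⟨h₁, h₂⟩
    · refine ⟨s e, t e, h₁, h₂, fun d hd => Below.of_lt hd, ?_, fun z hz => ?_,
        Or.inl h₁, Or.inr (mem_cluster_self _ _)⟩
      · by_contra hinf; exact hv e ⟨hfin, hmin, Or.inl ⟨h₁, Or.inl hinf⟩⟩
      · by_contra hlt; exact hv e ⟨hfin, hmin, Or.inl ⟨h₁, Or.inr ⟨z, hz, not_le.1 hlt⟩⟩⟩
    · refine ⟨t e, s e, h₁, h₂, fun d hd => (Below.of_lt hd).symm, ?_, fun z hz => ?_,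
        Or.inr (mem_cluster_self _ _), Or.inl h₁⟩
      · by_contra hinf; exact hv e ⟨hfin, hmin, Or.inr ⟨h₁, Or.inl hinf⟩⟩
      · by_contra hlt; exact hv e ⟨hfin, hmin, Or.inr ⟨h₁, Or.inr ⟨z, hz, not_le.1 hlt⟩⟩⟩
  -- Smaller edges preserve each of the two components, and `e` has both ends in their union.
  have hlt : ∀ d, ¬ (s d ∈ cluster s t e v ∪ cluster s t e y ↔
      t d ∈ cluster s t e v ∪ cluster s t e y) → e < d := by
    intro d hd
    by_contra hde
    rcases (not_lt.1 hde).lt_or_eq with h | rfl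
    · have hstep := Below.of_lt (s := s) (t := t) h
      apply hd
      constructor
      · rintro (h' | h')
        · exact Or.inl (Below.trans h' hstep)
        · exact Or.inr (Below.trans h' hstep)
      · rintro (h' | h')
        · exact Or.inl (Below.trans h' hstep.symm)
        · exact Or.inr (Below.trans h' hstep.symm)
    · exact hd ⟨fun _ => hte, fun _ => hse⟩
  obtain ⟨d, -, hd, hcl⟩ := exists_exits hconn hloc (M := cluster s t e v ∪ cluster s t e y)
    (hfin.union hyfin) (Or.inl (mem_cluster_self e v))
    (fun z hz => hz.elim (hmin z) (hymin z))
    (fun d hd z hz => by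
      have hed := hlt d hd
      rcases hz with hz | hz
      · exact Below.mono hed.le hz
      · exact ((hx.mono hed.le).trans (hxy d hed)).trans (Below.mono hed.le hz))
  refine ⟨d, hd, ?_⟩
  rw [hcl]
  exact ⟨subset_union_left, fun h => hy (h (Or.inr (mem_cluster_self e y)))⟩

lemma exists_large_exit [Infinite V]
    (hconn : ∀ f : V → ℚ, (∀ e, f (t e) = f (s e)) → ∀ x y, f x = f y)
    (hloc : ∀ x, {e | s e = x ∨ t e = x}.Finite) {v : V} (hv : ∀ e, ¬ Loses s t e v) (n : ℕ) :
    ∃ e, Exits s t v e ∧ n < (cluster s t e v).ncard := by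
  induction n with
  | zero =>
    obtain ⟨e, he⟩ := exists_first_exit hconn hloc v
    exact ⟨e, he, (Set.ncard_pos he.1).2 ⟨v, mem_cluster_self e v⟩⟩
  | succ n ih =>
    obtain ⟨e, he, hn⟩ := ih
    obtain ⟨d, hd, hlt⟩ := exists_next_exit hconn hloc hv he
    exact ⟨d, hd, (Nat.succ_le_of_lt hn).trans_lt (Set.ncard_lt_ncard hlt hd.1)⟩

/-- Two vertices that never lose and meet a common finite component coincide. -/
lemma le_of_forall_not_loses [Infinite V]
    (hconn : ∀ f : V → ℚ, (∀ e, f (t e) = f (s e)) → ∀ x y, f x = f y)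
    (hloc : ∀ x, {e | s e = x ∨ t e = x}.Finite) {v w u : V} (hw : ∀ e, ¬ Loses s t e w) {d e : E}
    (hv : Exits s t v e) (hd : Exits s t w d) (hvu : Below s t e v u) (hwu : Below s t d w u) :
    w ≤ v := by
  -- Components grow with the edge, so this size forces `c` to be at least `d` and `e`. The
  -- component of `w` below `c` then contains `v`, and `w` is its minimum.
  obtain ⟨c, hc, hcard⟩ := exists_large_exit hconn hloc hw
    (max (cluster s t e v).ncard (cluster s t d w).ncard)
  have hdc : d ≤ c := by
    by_contra! h
    exact absurd (Set.ncard_le_ncard (cluster_mono h.le w) hd.1)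
      (not_le.2 ((le_max_right _ _).trans_lt hcard))
  have hu : Below s t c w u := hwu.mono hdc
  have hec : e ≤ c := by
    by_contra! h
    refine absurd (Set.ncard_le_ncard (s := cluster s t c w) (t := cluster s t e v) ?_ hv.1)
      (not_le.2 ((le_max_left _ _).trans_lt hcard))
    rw [cluster_eq hu, cluster_eq hvu]
    exact cluster_mono h.le u
  exact hc.2.1 v (hu.trans (hvu.symm.mono hec))

end Clusters

/-! ### Counting orbits of essential edges -/

section Orbits

open MulAction

variable {L V E : Type*} [Group L] [MulAction L V] [MulAction L E]

/-- An equivariant relation that is injective in the first argument bounds numbers of orbits. -/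
lemma ncard_orbits_le [Finite (orbitRel.Quotient L V)] {S : Set E} {T : Set V} {R : E → V → Prop}
    (hR : ∀ (g : L) e v, R e v → R (g • e) (g • v)) (hST : ∀ e ∈ S, ∃ v ∈ T, R e v)
    (huniq : ∀ e d v, R e v → R d v → e = d) :
    ((Quotient.mk (orbitRel L E)) '' S).ncard ≤ ((Quotient.mk (orbitRel L V)) '' T).ncard := by
  rcases S.eq_empty_or_nonempty with rfl | ⟨e₀, he₀⟩
  · simp
  have : Nonempty E := ⟨e₀⟩
  have : Nonempty V := ⟨(hST e₀ he₀).choose⟩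
  have hch : ∀ q ∈ (Quotient.mk (orbitRel L E)) '' S, ∃ v ∈ T, ∃ e,
      Quotient.mk (orbitRel L E) e = q ∧ R e v := by
    rintro _ ⟨e, he, rfl⟩
    obtain ⟨v, hv, h⟩ := hST e he
    exact ⟨v, hv, e, rfl, h⟩
  choose! f hfT e he hR' using hch
  refine Set.ncard_le_ncard_of_injOn (fun q => Quotient.mk (orbitRel L V) (f q))
    (fun q hq => ⟨_, hfT q hq, rfl⟩) ?_ (Set.toFinite _)
  intro q hq q' hq' heq
  obtain ⟨g, hg⟩ : ∃ g : L, g • f q' = f q := Quotient.exact heq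
  have : e q = g • e q' := huniq _ _ _ (hR' q hq) (hg ▸ hR g _ _ (hR' q' hq'))
  rw [← he q hq, ← he q' hq']
  exact Quotient.sound ⟨g, this.symm⟩

variable [LinearOrder E] {s t : E → V} (hs : ∀ (g : L) e, s (g • e) = g • s e)
  (ht : ∀ (g : L) e, t (g • e) = g • t e) (hE : ∀ (g : L) (d e : E), d < e → g • d < g • e)

include hs ht hE

lemma Below.smul (g : L) {e : E} {x y : V} (h : Below s t e x y) :
    Below s t (g • e) (g • x) (g • y) := by
  induction h with
  | rel x y h =>
    obtain ⟨d, hd, rfl, rfl⟩ := h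
    rw [← hs, ← ht]
    exact Below.of_lt (hE g d e hd)
  | refl => exact Below.refl _ _
  | symm _ _ _ ih => exact ih.symm
  | trans _ _ _ _ _ ih₁ ih₂ => exact ih₁.trans ih₂

lemma cluster_smul (g : L) (e : E) (x : V) :
    cluster s t (g • e) (g • x) = (g • ·) '' cluster s t e x := by
  refine Set.ext fun y => ⟨fun hy => ⟨g⁻¹ • y, ?_, smul_inv_smul g y⟩, ?_⟩
  · have := Below.smul hs ht hE g⁻¹ hy
    rwa [inv_smul_smul, inv_smul_smul] at this
  · rintro ⟨y, hy, rfl⟩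
    exact Below.smul hs ht hE g hy

lemma cluster_smul_infinite (g : L) (e : E) (x : V) :
    (cluster s t (g • e) (g • x)).Infinite ↔ (cluster s t e x).Infinite := by
  rw [cluster_smul hs ht hE, Set.infinite_image_iff (MulAction.injective g).injOn]

lemma isEssential_smul (g : L) (e : E) :
    IsEssential s t (g • e) ↔ IsEssential s t e := by
  unfold IsEssential
  rw [hs, ht, cluster_smul_infinite hs ht hE, cluster_smul_infinite hs ht hE]

variable [LinearOrder V] (hV : ∀ (g : L) (x y : V), x < y → g • x < g • y)

include hV

lemma min_cluster_smul (g : L) {e : E} {v : V} (h : ∀ y ∈ cluster s t e v, v ≤ y) :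
    ∀ y ∈ cluster s t (g • e) (g • v), g • v ≤ y := by
  rw [cluster_smul hs ht hE]
  rintro _ ⟨y, hy, rfl⟩
  exact (h y hy).lt_or_eq.elim (fun h => (hV g _ _ h).le) fun h => h ▸ le_rfl

lemma Loses.smul (g : L) {e : E} {v : V} (h : Loses s t e v) : Loses s t (g • e) (g • v) := by
  have hsmaller : ∀ x, ((cluster s t e x).Infinite ∨ ∃ y ∈ cluster s t e x, y < v) →
      (cluster s t (g • e) (g • x)).Infinite ∨ ∃ y ∈ cluster s t (g • e) (g • x), y < g • v := by
    rintro x (hx | ⟨y, hy, hyv⟩)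
    · exact Or.inl ((cluster_smul_infinite hs ht hE g e x).2 hx)
    · exact Or.inr ⟨g • y, Below.smul hs ht hE g hy, hV g _ _ hyv⟩
  obtain ⟨hf, hm, h⟩ := h
  refine ⟨cluster_smul hs ht hE g e v ▸ hf.image _, min_cluster_smul hs ht hE hV g hm, ?_⟩
  rw [hs, ht]
  exact h.imp (fun h => ⟨Below.smul hs ht hE g h.1, hsmaller _ h.2⟩)
    fun h => ⟨Below.smul hs ht hE g h.1, hsmaller _ h.2⟩

lemma Exits.smul (g : L) {e : E} {v : V} (h : Exits s t v e) : Exits s t (g • v) (g • e) := by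
  have hiff : ∀ x, Below s t (g • e) (g • v) (g • x) ↔ Below s t e v x := fun x =>
    ⟨fun h => by
      have := Below.smul hs ht hE g⁻¹ h
      rwa [inv_smul_smul, inv_smul_smul, inv_smul_smul] at this, Below.smul hs ht hE g⟩
  obtain ⟨hf, hm, h⟩ := h
  refine ⟨cluster_smul hs ht hE g e v ▸ hf.image _, min_cluster_smul hs ht hE hV g hm, ?_⟩
  rwa [hs, ht, hiff, hiff]

/-- In an infinite connected graph with a free action with finitely many orbits of vertices, every
vertex loses. -/
lemma exists_loses_of_free [Infinite V] [Finite (orbitRel.Quotient L V)]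
    (hfree : ∀ (g : L) (x : V), g • x = x → g = 1)
    (hconn : ∀ f : V → ℚ, (∀ e, f (t e) = f (s e)) → ∀ x y, f x = f y)
    (hloc : ∀ x, {e | s e = x ∨ t e = x}.Finite) (v : V) : ∃ e, Loses s t e v := by
  by_contra! hv
  -- More vertices than orbits give distinct `y` and `g • y` in one component. Then `g • y` also
  -- lies in the translated component, and the minima `v` and `g • v`, which never lose, must
  -- coincide.
  obtain ⟨e, he, hcard⟩ := exists_large_exit hconn hloc hv (Nat.card (orbitRel.Quotient L V))
  obtain ⟨x, hx, y, hy, hxy, heq⟩ : ∃ x ∈ cluster s t e v, ∃ y ∈ cluster s t e v, x ≠ y ∧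
      Quotient.mk (orbitRel L V) x = Quotient.mk (orbitRel L V) y := by
    rw [← Set.ncard_univ] at hcard
    obtain ⟨x, hx, y, hy, h⟩ := Set.exists_ne_map_eq_of_ncard_lt_of_maps_to hcard
      (f := Quotient.mk (orbitRel L V)) (fun _ _ => mem_univ _)
    exact ⟨x, hx, y, hy, h⟩
  obtain ⟨g, rfl⟩ : ∃ g : L, g • y = x := Quotient.exact heq
  have hgv : ∀ e, ¬ Loses s t e (g • v) := fun e h => hv (g⁻¹ • e) (by
    have := Loses.smul hs ht hE hV g⁻¹ h
    rwa [inv_smul_smul] at this)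
  have hge := Exits.smul hs ht hE hV g he
  have hgy := Below.smul hs ht hE g hy
  have := hfree g v (le_antisymm (le_of_forall_not_loses hconn hloc hgv he hge hx hgy)
    (le_of_forall_not_loses hconn hloc hv hge he hgy hx))
  exact hxy (by rw [this, one_smul])

/-- In a forest, all but as many edge orbits as there are vertex orbits are essential. -/
lemma card_edge_orbits_le [Finite (orbitRel.Quotient L V)] [Finite (orbitRel.Quotient L E)]
    (hpot : ∀ c : E → ℚ, ∃ f : V → ℚ, ∀ e, f (t e) - f (s e) = c e) :
    Nat.card (orbitRel.Quotient L E) ≤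
      ((Quotient.mk (orbitRel L E)) '' {e | IsEssential s t e}).ncard +
        Nat.card (orbitRel.Quotient L V) := by
  have h := ncard_orbits_le (L := L) (S := {e | ¬ IsEssential s t e}) (T := Set.univ)
    (R := Loses s t) (fun g _ _ h => Loses.smul hs ht hE hV g h)
    (fun e he => (exists_loses hpot he).imp fun v hv => ⟨mem_univ v, hv⟩)
    fun _ _ _ => Loses.edge_unique
  have huniv : (Set.univ : Set (orbitRel.Quotient L E)) =
      (Quotient.mk (orbitRel L E)) '' {e | IsEssential s t e} ∪
        (Quotient.mk (orbitRel L E)) '' {e | ¬ IsEssential s t e} := by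
    rw [← Set.image_union]
    refine (Set.eq_univ_of_forall fun q => ?_).symm
    obtain ⟨e, rfl⟩ := Quotient.exists_rep q
    exact ⟨e, em _, rfl⟩
  rw [← Set.ncard_univ, huniv, ← Set.ncard_univ (orbitRel.Quotient L V)]
  exact (Set.ncard_union_le _ _).trans (Nat.add_le_add_left
    (h.trans (Set.ncard_le_ncard (subset_univ _) (Set.toFinite _))) _)

/-- Sending each vertex to the edge at which it loses injects vertex orbits into inessential edge
orbits, which are disjoint from the essential ones by invariance. -/
lemma card_vertex_orbits_add_le [Infinite V] [Finite (orbitRel.Quotient L V)]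
    [Finite (orbitRel.Quotient L E)]
    (hfree : ∀ (g : L) (x : V), g • x = x → g = 1)
    (hconn : ∀ f : V → ℚ, (∀ e, f (t e) = f (s e)) → ∀ x y, f x = f y)
    (hloc : ∀ x, {e | s e = x ∨ t e = x}.Finite) :
    ((Quotient.mk (orbitRel L E)) '' {e | IsEssential s t e}).ncard +
        Nat.card (orbitRel.Quotient L V) ≤ Nat.card (orbitRel.Quotient L E) := by
  have h := ncard_orbits_le (L := L) (S := (Set.univ : Set V)) (T := {e | ¬ IsEssential s t e})
    (R := fun v e => Loses s t e v) (fun g _ _ h => Loses.smul hs ht hE hV g h)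
    (fun v _ => (exists_loses_of_free hs ht hE hV hfree hconn hloc v).imp
      fun e he => ⟨he.not_isEssential, he⟩)
    fun _ _ _ => Loses.vertex_unique
  have hV' : (Quotient.mk (orbitRel L V)) '' Set.univ = Set.univ :=
    Set.image_univ_of_surjective Quotient.mk_surjective
  rw [hV', Set.ncard_univ] at h
  have hdisj : Disjoint ((Quotient.mk (orbitRel L E)) '' {e | IsEssential s t e})
      ((Quotient.mk (orbitRel L E)) '' {e | ¬ IsEssential s t e}) := by
    rw [Set.disjoint_left]
    rintro _ ⟨e, he, rfl⟩ ⟨d, hd, hde⟩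
    obtain ⟨g, hg⟩ : ∃ g : L, g • e = d := Quotient.exact hde
    exact hd (hg ▸ (isEssential_smul hs ht hE g e).2 he)
  refine (Nat.add_le_add_left h _).trans ?_
  rw [← Set.ncard_union_eq hdisj (Set.toFinite _) (Set.toFinite _),
    ← Set.ncard_univ (orbitRel.Quotient L E)]
  exact Set.ncard_le_ncard (subset_univ _) (Set.toFinite _)

end Orbits

end EdgeOrder

namespace EdgeOrder

open MulAction Module

/-! ### Euler characteristic of the quotient of a tree -/

section Betti

variable {L V E : Type*} [Group L] [MulAction L V] [MulAction L E] (s t : E → V)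

/-- Functions on the vertices that are equivariant up to a homomorphism, with that homomorphism. -/
def equivariantFunctions (L V : Type*) [Group L] [MulAction L V] :
    Submodule ℚ ((V → ℚ) × (Additive L →+ ℚ)) where
  carrier := {p | ∀ (g : L) (v : V), p.1 (g • v) = p.1 v + p.2 (Additive.ofMul g)}
  add_mem' {p q} hp hq g v := by
    simp only [Prod.fst_add, Prod.snd_add, Pi.add_apply, AddMonoidHom.add_apply]
    rw [hp, hq]; ring
  zero_mem' g v := by simp
  smul_mem' c p hp g v := by
    simp only [Prod.smul_fst, Prod.smul_snd, Pi.smul_apply, AddMonoidHom.smul_apply, smul_eq_mul]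
    rw [hp]; ring

variable {s t} (hs : ∀ (g : L) e, s (g • e) = g • s e) (ht : ∀ (g : L) e, t (g • e) = g • t e)

/-- The coboundary of an equivariant function, as a function on the edge orbits, together with the
value of the function at `v₀`. -/
def coboundary (v₀ : V) : equivariantFunctions L V →ₗ[ℚ] (orbitRel.Quotient L E → ℚ) × ℚ where
  toFun p := (fun q => Quotient.liftOn q (fun e => p.1.1 (t e) - p.1.1 (s e)) (by
    rintro _ e ⟨g, rfl⟩
    simp only [hs, ht]
    rw [p.2, p.2]; ring), p.1.1 v₀)
  map_add' p q := by
    refine Prod.ext ?_ rfl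
    ext x
    induction x using Quotient.inductionOn with | _ e =>
    simp only [Quotient.liftOn_mk, Submodule.coe_add, Prod.fst_add, Pi.add_apply]
    ring
  map_smul' c p := by
    refine Prod.ext ?_ rfl
    ext x
    induction x using Quotient.inductionOn with | _ e =>
    simp only [Quotient.liftOn_mk, Submodule.coe_smul, Prod.smul_fst, Pi.smul_apply, smul_eq_mul,
      RingHom.id_apply]
    ring

lemma coboundary_mk (v₀ : V) (p : equivariantFunctions L V) (e : E) :
    (coboundary hs ht v₀ p).1 (Quotient.mk (orbitRel L E) e) = p.1.1 (t e) - p.1.1 (s e) := rfl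

lemma coboundary_surjective (v₀ : V)
    (hpot : ∀ c : E → ℚ, ∃ f : V → ℚ, ∀ e, f (t e) - f (s e) = c e)
    (hconn : ∀ f : V → ℚ, (∀ e, f (t e) = f (s e)) → ∀ x y, f x = f y) :
    Function.Surjective (coboundary (L := L) hs ht v₀) := by
  rintro ⟨c, a⟩
  obtain ⟨f, hf⟩ := hpot fun e => c (Quotient.mk (orbitRel L E) e)
  have hinv : ∀ (g : L) (e : E), Quotient.mk (orbitRel L E) (g • e) = Quotient.mk _ e :=
    fun g e => Quotient.sound ⟨g, rfl⟩
  -- The coboundary of `f` is invariant, so `f (g • x) - f x` has zero coboundary in `x`; its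
  -- constant value is additive in `g`.
  have hconst : ∀ (g : L) (x y : V), f (g • x) - f x = f (g • y) - f y := fun g =>
    hconn (fun x => f (g • x) - f x) fun e => by
      have h₁ := hf (g • e)
      rw [hinv, hs, ht] at h₁
      have h₂ := hf e
      linarith
  let φ : Additive L →+ ℚ := AddMonoidHom.mk' (fun g => f (g.toMul • v₀) - f v₀) fun g h => by
    have := hconst g.toMul (h.toMul • v₀) v₀
    simp only [toMul_add, mul_smul]
    linarith
  have hmem : ((fun v => f v - f v₀ + a, φ) : (V → ℚ) × (Additive L →+ ℚ)) ∈
      equivariantFunctions L V := fun g v => by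
    have := hconst g v v₀
    simp only [φ, AddMonoidHom.mk'_apply, toMul_ofMul]
    linarith
  refine ⟨⟨_, hmem⟩, Prod.ext (funext fun q => ?_) ?_⟩
  · induction q using Quotient.inductionOn with | _ e =>
    change (f (t e) - f v₀ + a) - (f (s e) - f v₀ + a) = c (Quotient.mk (orbitRel L E) e)
    rw [← hf e]
    ring
  · exact (congrArg (· + a) (sub_self (f v₀))).trans (zero_add a)

lemma coboundary_injective (v₀ : V)
    (hconn : ∀ f : V → ℚ, (∀ e, f (t e) = f (s e)) → ∀ x y, f x = f y) :
    Function.Injective (coboundary (L := L) hs ht v₀) := by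
  rw [injective_iff_map_eq_zero]
  rintro ⟨⟨f, φ⟩, hp⟩ h
  have hf := hconn f fun e => by
    have := congrFun (congrArg Prod.fst h) (Quotient.mk _ e)
    rw [coboundary_mk] at this
    simpa [sub_eq_zero] using this
  have hf₀ : ∀ v, f v = 0 := fun v => (hf v v₀).trans (congrArg Prod.snd h)
  refine Subtype.ext (Prod.ext (funext hf₀) ?_)
  ext g
  have := hp g v₀
  simpa [hf₀] using this.symm

/-- The values of an equivariant function at chosen representatives of the vertex orbits, and the
associated homomorphism. -/
noncomputable def values (L V : Type*) [Group L] [MulAction L V] :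
    equivariantFunctions L V →ₗ[ℚ] (orbitRel.Quotient L V → ℚ) × (Additive L →+ ℚ) where
  toFun p := (fun q => p.1.1 q.out, p.1.2)
  map_add' _ _ := rfl
  map_smul' _ _ := rfl

/-- By freeness each vertex is a unique translate of its representative, so the values at
representatives can be prescribed independently and determine the rest. -/
lemma values_bijective (hfree : ∀ (g : L) (x : V), g • x = x → g = 1) :
    Function.Bijective (values L V) := by
  have hrep : ∀ v : V, ∃ g : L, g • (Quotient.mk (orbitRel L V) v).out = v := fun v =>
    Quotient.exact (Quotient.out_eq (Quotient.mk (orbitRel L V) v)).symm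
  choose γ hγ using hrep
  constructor
  · rw [injective_iff_map_eq_zero]
    rintro ⟨⟨f, φ⟩, hp⟩ h
    have hφ : φ = 0 := congrArg Prod.snd h
    subst hφ
    refine Subtype.ext (Prod.ext (funext fun v => ?_) rfl)
    have h₁ := hp (γ v) (Quotient.mk (orbitRel L V) v).out
    rw [hγ] at h₁
    have h₂ : f (Quotient.mk (orbitRel L V) v).out = 0 := congrFun (congrArg Prod.fst h) _
    simpa [h₂] using h₁
  · rintro ⟨c, φ⟩
    have hmk : ∀ (g : L) (v : V), Quotient.mk (orbitRel L V) (g • v) = Quotient.mk _ v :=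
      fun g v => Quotient.sound ⟨g, rfl⟩
    have huniq : ∀ (g : L) (v : V), g • (Quotient.mk (orbitRel L V) v).out = v → γ v = g := by
      intro g v hg
      have := hfree (g⁻¹ * γ v) (Quotient.mk (orbitRel L V) v).out (by
        rw [mul_smul, hγ, inv_smul_eq_iff, hg])
      exact (inv_mul_eq_one.1 this).symm
    have hmul : ∀ (g : L) (v : V), γ (g • v) = g * γ v := fun g v =>
      huniq _ _ (by rw [hmk, mul_smul, hγ])
    refine ⟨⟨(fun v => c (Quotient.mk _ v) + φ (Additive.ofMul (γ v)), φ), fun g v => ?_⟩,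
      Prod.ext (funext fun q => ?_) rfl⟩
    · simp only [hmul, hmk, ofMul_mul, map_add]
      ring
    · have h₁ : γ q.out = 1 := huniq 1 _ (by rw [Quotient.out_eq, one_smul])
      change c (Quotient.mk (orbitRel L V) q.out) + φ (Additive.ofMul (γ q.out)) = c q
      rw [h₁, Quotient.out_eq, ofMul_one, map_zero, add_zero]

/-- The Euler characteristic of the quotient of a tree by a free action. -/
theorem finrank_hom_add_card [Nonempty V] [Finite (orbitRel.Quotient L V)]
    [Finite (orbitRel.Quotient L E)] (hfree : ∀ (g : L) (x : V), g • x = x → g = 1)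
    (hs : ∀ (g : L) e, s (g • e) = g • s e) (ht : ∀ (g : L) e, t (g • e) = g • t e)
    (hpot : ∀ c : E → ℚ, ∃ f : V → ℚ, ∀ e, f (t e) - f (s e) = c e)
    (hconn : ∀ f : V → ℚ, (∀ e, f (t e) = f (s e)) → ∀ x y, f x = f y) :
    Module.Finite ℚ (Additive L →+ ℚ) ∧
    finrank ℚ (Additive L →+ ℚ) + Nat.card (orbitRel.Quotient L V) =
      Nat.card (orbitRel.Quotient L E) + 1 := by
  obtain ⟨v₀⟩ := ‹Nonempty V›
  have : Fintype (orbitRel.Quotient L E) := Fintype.ofFinite _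
  have : Fintype (orbitRel.Quotient L V) := Fintype.ofFinite _
  -- One space, two dimension counts: `|V/L| + dim Hom(L, ℚ)` by values and `|E/L| + 1` by
  -- coboundaries.
  let e := (LinearEquiv.ofBijective (values L V) (values_bijective hfree)).symm.trans
    (LinearEquiv.ofBijective (coboundary (L := L) hs ht v₀)
      ⟨coboundary_injective hs ht v₀ hconn, coboundary_surjective hs ht v₀ hpot hconn⟩)
  have hfin : Module.Finite ℚ (Additive L →+ ℚ) :=
    Module.Finite.of_surjective ((LinearMap.snd ℚ (orbitRel.Quotient L V → ℚ) _).comp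
      e.symm.toLinearMap) (Prod.snd_surjective.comp e.symm.surjective)
  have h := e.finrank_eq
  rw [Module.finrank_prod, Module.finrank_prod, Module.finrank_fintype_fun_eq_card,
    Module.finrank_fintype_fun_eq_card, Module.finrank_self] at h
  refine ⟨hfin, ?_⟩
  rw [Nat.card_eq_fintype_card, Nat.card_eq_fintype_card]
  omega

end Betti

/-! ### Rank as the dimension of homomorphisms to the rationals -/

section Rank

variable {L : Type*} [Group L]

/-- Restriction of homomorphisms to a generating set is injective. -/
lemma exists_injective_restriction {S : Finset L} (hS : Subgroup.closure (S : Set L) = ⊤) :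
    ∃ r : (Additive L →+ ℚ) →ₗ[ℚ] (S → ℚ), Function.Injective r := by
  refine ⟨{ toFun := fun φ x => φ (Additive.ofMul x.1)
            map_add' := fun _ _ => rfl
            map_smul' := fun _ _ => rfl }, fun φ ψ h => ?_⟩
  have : (AddMonoidHom.toMultiplicativeRight φ) = (AddMonoidHom.toMultiplicativeRight ψ) :=
    MonoidHom.eq_of_eqOn_dense hS fun x hx => congrArg Multiplicative.ofAdd (congrFun h ⟨x, hx⟩)
  exact AddMonoidHom.toMultiplicativeRight.injective this

lemma finite_hom_of_fg [Group.FG L] : Module.Finite ℚ (Additive L →+ ℚ) := by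
  obtain ⟨S, -, hS⟩ := Group.rank_spec L
  obtain ⟨r, hr⟩ := exists_injective_restriction hS
  exact Module.Finite.of_injective r hr

lemma finrank_hom_le_rank [Group.FG L] : finrank ℚ (Additive L →+ ℚ) ≤ Group.rank L := by
  obtain ⟨S, hcard, hS⟩ := Group.rank_spec L
  obtain ⟨r, hr⟩ := exists_injective_restriction hS
  refine (LinearMap.finrank_le_finrank_of_injective hr).trans ?_
  rw [Module.finrank_fintype_fun_eq_card, Fintype.card_coe, hcard]

/-- A basis of a free group with finitely many independent homomorphisms to `ℚ` is finite. -/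
lemma finite_basis_of_finite_hom {ι : Type*} (b : FreeGroupBasis ι L)
    [Module.Finite ℚ (Additive L →+ ℚ)] :
    Finite ι ∧ Nat.card ι ≤ finrank ℚ (Additive L →+ ℚ) := by
  let r : (Additive L →+ ℚ) →ₗ[ℚ] (ι → ℚ) :=
    { toFun := fun φ x => φ (Additive.ofMul (b x))
      map_add' := fun _ _ => rfl
      map_smul' := fun _ _ => rfl }
  have hr : Function.Surjective r := fun f =>
    ⟨AddMonoidHom.toMultiplicativeRight.symm (b.lift fun i => Multiplicative.ofAdd (f i)), by
      funext i
      exact congrArg Multiplicative.toAdd (congrFun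
        (b.lift.symm_apply_apply fun i => Multiplicative.ofAdd (f i)) i)⟩
  have hfin : Module.Finite ℚ (ι → ℚ) := Module.Finite.of_surjective r hr
  have hι : Finite ι :=
    (Module.finite_finsupp_self_iff.1 (Module.Finite.of_injective
      (Finsupp.lcoeFun : (ι →₀ ℚ) →ₗ[ℚ] (ι → ℚ)) DFunLike.coe_injective)).resolve_left
        (not_subsingleton ℚ)
  have : Fintype ι := Fintype.ofFinite ι
  refine ⟨hι, ?_⟩
  rw [Nat.card_eq_fintype_card, ← Module.finrank_fintype_fun_eq_card (R := ℚ)]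
  exact LinearMap.finrank_le_finrank_of_surjective hr

/-- Finite generation is a conclusion: finite dimension bounds the size of a basis. This is how `H ⊓
K` is seen to be finitely generated. -/
lemma rank_le_finrank_hom [IsFreeGroup L] [Module.Finite ℚ (Additive L →+ ℚ)] :
    ∃ _ : Group.FG L, Group.rank L ≤ finrank ℚ (Additive L →+ ℚ) := by
  classical
  let b := IsFreeGroup.basis L
  obtain ⟨hfin, hcard⟩ := finite_basis_of_finite_hom b
  have : Fintype (IsFreeGroup.Generators L) := Fintype.ofFinite _
  have hgen : Subgroup.closure ((Finset.univ.image b : Finset L) : Set L) = ⊤ := by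
    rw [Finset.coe_image, Finset.coe_univ, Set.image_univ]
    have h := congrArg (Subgroup.map b.repr.symm.toMonoidHom)
      (FreeGroup.closure_range_of (IsFreeGroup.Generators L))
    rw [MonoidHom.map_closure, ← Set.range_comp, ← MonoidHom.range_eq_map,
      MonoidHom.range_eq_top.2 b.repr.symm.surjective] at h
    exact h
  have hfg : Group.FG L := ⟨⟨_, hgen⟩⟩
  refine ⟨hfg, (Group.rank_le hgen).trans (Finset.card_image_le.trans ?_)⟩
  rwa [Finset.card_univ, ← Nat.card_eq_fintype_card]

end Rank

end EdgeOrder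

/-! ### Left-orderability of free groups -/

namespace FreeGroup

/-- A finite order-preserving relation on `ℚ` extends to an order automorphism. -/
lemma exists_orderIso_extending (p : Order.PartialIso ℚ ℚ) :
    ∃ f : ℚ ≃o ℚ, ∀ x ∈ p.val, f x.1 = x.2 := by
  let cof : ℚ ⊕ ℚ → Order.Cofinal (Order.PartialIso ℚ ℚ) := fun q =>
    Sum.recOn q (Order.PartialIso.definedAtLeft ℚ) (Order.PartialIso.definedAtRight ℚ)
  let I := Order.idealOfCofinals p cof
  let F a := Order.PartialIso.funOfIdeal a I (Order.cofinal_meets_idealOfCofinals _ cof (Sum.inl a))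
  let G b := Order.PartialIso.invOfIdeal b I (Order.cofinal_meets_idealOfCofinals _ cof (Sum.inr b))
  refine ⟨OrderIso.ofCmpEqCmp (fun a => (F a).val) (fun b => (G b).val) fun a b => ?_, ?_⟩
  · obtain ⟨f, hf, ha⟩ := (F a).prop
    obtain ⟨g, hg, hb⟩ := (G b).prop
    obtain ⟨m, -, fm, gm⟩ := I.directed _ hf _ hg
    exact m.prop (a, _) (fm ha) (_, b) (gm hb)
  · intro x hx
    obtain ⟨f, hf, ha⟩ := (F x.1).prop
    obtain ⟨m, -, fm, gm⟩ := I.directed _ hf _ (Order.mem_idealOfCofinals p cof)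
    have h := m.prop (x.1, (F x.1).val) (fm ha) x (gm hx)
    exact cmp_eq_eq_iff _ _ |>.1 (h.symm.trans (cmp_eq_eq_iff _ _ |>.2 rfl))

/-- The steps `x ↦ y` along the word `w`, read as a path from `w.length` down to `0`, that the
generator `a` has to take. -/
def wordSteps {α : Type*} [DecidableEq α] (w : List (α × Bool)) (a : α) : Finset (ℚ × ℚ) :=
  (Finset.univ.filter fun i : Fin w.length => (w.get i).1 = a).image fun i =>
    if (w.get i).2 then ((i : ℚ) + 1, (i : ℚ)) else ((i : ℚ), (i : ℚ) + 1)

/-- Steps of one generator at distant positions are ordered like the positions; at adjacent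
positions reducedness gives them the same direction, so they never conflict. -/
lemma wordSteps_cmp {α : Type*} [DecidableEq α] {w : List (α × Bool)} (hw : IsReduced w) (a : α) :
    ∀ p ∈ wordSteps w a, ∀ q ∈ wordSteps w a, cmp p.1 q.1 = cmp p.2 q.2 := by
  have hadj : ∀ i (hi : i + 1 < w.length), w[i].1 = a → w[i + 1].1 = a → w[i].2 = w[i + 1].2 :=
    fun i hi h h' => List.isChain_iff_getElem.1 hw i hi (h.trans h'.symm)
  have key : ∀ i j : Fin w.length, i < j → (w.get i).1 = a → (w.get j).1 = a →
      (i : ℚ) + 1 < j ∨ ((i : ℚ) + 1 = j ∧ (w.get i).2 = (w.get j).2) := by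
    intro i j hij hi hj
    rcases (Nat.succ_le_of_lt (Fin.lt_def.1 hij)).lt_or_eq with h | h
    · exact Or.inl (by exact_mod_cast h)
    · refine Or.inr ⟨by exact_mod_cast h, ?_⟩
      have hj' : i.1 + 1 < w.length := lt_of_eq_of_lt h j.2
      obtain rfl : j = ⟨i.1 + 1, hj'⟩ := Fin.ext h.symm
      exact hadj i.1 hj' hi hj
  have hlt : ∀ i j : Fin w.length, i < j → (w.get i).1 = a → (w.get j).1 = a →
      let f := fun i : Fin w.length =>
        if (w.get i).2 then ((i : ℚ) + 1, (i : ℚ)) else ((i : ℚ), (i : ℚ) + 1)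
      (f i).1 < (f j).1 ∧ (f i).2 < (f j).2 := by
    intro i j hij hi hj f
    rcases key i j hij hi hj with h | ⟨h, h'⟩
    · simp only [f]; split_ifs <;> constructor <;> dsimp only <;> linarith
    · simp only [f, h']; split_ifs <;> constructor <;> dsimp only <;> linarith
  intro p hp q hq
  simp only [wordSteps, Finset.mem_image, Finset.mem_filter, Finset.mem_univ, true_and] at hp hq
  obtain ⟨i, hi, rfl⟩ := hp
  obtain ⟨j, hj, rfl⟩ := hq
  rcases lt_trichotomy i j with h | rfl | h
  · obtain ⟨h₁, h₂⟩ := hlt i j h hi hj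
    rw [(cmp_eq_lt_iff _ _).2 h₁, (cmp_eq_lt_iff _ _).2 h₂]
  · rw [cmp_self_eq_eq, cmp_self_eq_eq]
  · obtain ⟨h₁, h₂⟩ := hlt j i h hj hi
    rw [(cmp_eq_gt_iff _ _).2 h₁, (cmp_eq_gt_iff _ _).2 h₂]

/-- Every nontrivial element of a free group moves a point in some action on `ℚ` by order
automorphisms. -/
lemma exists_orderIso_action_ne {α : Type*} {g : FreeGroup α} (hg : g ≠ 1) :
    ∃ (φ : FreeGroup α →* (ℚ ≃o ℚ)) (x : ℚ), φ g x ≠ x := by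
  classical
  set w := g.toWord with hw
  have hred : IsReduced w := isReduced_toWord
  choose f hf using fun a => exists_orderIso_extending ⟨wordSteps w a, wordSteps_cmp hred a⟩
  let φ : FreeGroup α →* (ℚ ≃o ℚ) := lift f
  have hstep : ∀ i : Fin w.length, φ (mk [w.get i]) ((i : ℚ) + 1) = i := by
    intro i
    have hmem : (if (w.get i).2 then ((i : ℚ) + 1, (i : ℚ)) else ((i : ℚ), (i : ℚ) + 1)) ∈
        wordSteps w (w.get i).1 :=
      Finset.mem_image.2 ⟨i, by simp, rfl⟩
    have hval := hf _ _ hmem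
    rcases h : w.get i with ⟨a, b⟩
    rw [h] at hval
    cases b
    · have hinv : φ (mk [(a, false)]) = (f a)⁻¹ := by simp [φ, lift_mk]
      rw [hinv]
      simp only [Bool.false_eq_true, if_false] at hval
      rw [← hval]
      exact (f a).symm_apply_apply _
    · have hpos : φ (mk [(a, true)]) = f a := by simp [φ, lift_mk]
      rw [hpos]
      simpa using hval
  -- Each letter carries `i + 1` to `i`. For the whole word, `g` carries `w.length ≠ 0` to `0`.
  have hdrop : ∀ i ≤ w.length, φ (mk (w.take i)) (i : ℚ) = 0 := by
    intro i
    induction i with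
    | zero => intro _; simp [← one_eq_mk]
    | succ i ih =>
      intro hi
      have := hstep ⟨i, hi⟩
      rw [List.take_succ_eq_append_getElem hi, ← mul_mk, _root_.map_mul]
      change φ (mk (w.take i)) (φ (mk [w[i]]) ((i + 1 : ℕ) : ℚ)) = 0
      push_cast
      rw [show φ (mk [w[i]]) ((i : ℚ) + 1) = i from this]
      exact ih (Nat.le_of_succ_le hi)
  refine ⟨φ, w.length, ?_⟩
  have := hdrop w.length le_rfl
  rw [List.take_length, hw, mk_toWord] at this
  rw [hw, this]
  have hne : g.toWord ≠ [] := fun h => hg (toWord_eq_nil_iff.1 h)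
  have := List.length_pos_iff.2 hne
  exact_mod_cast this.ne

/-- Free groups are left-orderable. -/
theorem exists_linearOrder_mul_left (α : Type*) :
    ∃ _ : LinearOrder (FreeGroup α), ∀ g x y : FreeGroup α, x < y → g * x < g * y := by
  classical
  let W := {g : FreeGroup α // g ≠ 1}
  let _ : LinearOrder W := linearOrderOfSTO WellOrderingRel
  have _ : WellFoundedLT W := ⟨WellOrderingRel.isWellOrder.wf⟩
  choose φ x hx using fun w : W => exists_orderIso_action_ne w.2
  -- The images of all test points are recorded. Left multiplication acts on each coordinate by an
  -- increasing map, hence preserves the lexicographic order.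
  let Φ : FreeGroup α → Lex (W → ℚ) := fun g => toLex fun w => φ w g (x w)
  have hΦ : Function.Injective Φ := by
    intro g h hgh
    by_contra hne
    have hne' : g⁻¹ * h ≠ 1 := fun h' => hne (inv_mul_eq_one.1 h')
    have h₁ : φ ⟨_, hne'⟩ g (x ⟨_, hne'⟩) = φ ⟨_, hne'⟩ h (x ⟨_, hne'⟩) :=
      congrFun (toLex.injective hgh) ⟨_, hne'⟩
    apply hx ⟨_, hne'⟩
    change φ ⟨_, hne'⟩ (g⁻¹ * h) _ = _
    rw [_root_.map_mul, _root_.map_inv]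
    change (φ ⟨_, hne'⟩ g).symm (φ ⟨_, hne'⟩ h _) = _
    rw [← h₁, OrderIso.symm_apply_apply]
  refine ⟨LinearOrder.lift' Φ hΦ, fun g a b hab => ?_⟩
  obtain ⟨w, hw, hlt⟩ : Pi.Lex (· < ·) (· < ·) (ofLex (Φ a)) (ofLex (Φ b)) := hab
  have hmul : ∀ c w, ofLex (Φ (g * c)) w = φ w g (ofLex (Φ c) w) := fun c w => by
    simp only [Φ, ofLex_toLex, _root_.map_mul]; rfl
  refine (⟨w, fun v hv => ?_, ?_⟩ :
    Pi.Lex (· < ·) (· < ·) (ofLex (Φ (g * a))) (ofLex (Φ (g * b))))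
  · rw [hmul, hmul, hw v hv]
  · simp only [hmul]
    exact (φ w g).strictMono hlt

end FreeGroup

/-! ### The Cayley tree and its subtrees -/

open EdgeOrder MulAction Module

/-- The edges of the Cayley graph of a free group: an edge runs from `src` to `src * of lab`. -/
@[ext]
structure CayleyEdge (α : Type*) where
  src : FreeGroup α
  lab : α

namespace CayleyEdge

variable {α : Type*}

def tgt (e : CayleyEdge α) : FreeGroup α := e.src * FreeGroup.of e.lab

instance : MulAction (FreeGroup α) (CayleyEdge α) where
  smul g e := ⟨g * e.src, e.lab⟩
  one_smul _ := CayleyEdge.ext (one_mul _) rfl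
  mul_smul _ _ _ := CayleyEdge.ext (mul_assoc _ _ _) rfl

@[simp] lemma smul_src (g : FreeGroup α) (e : CayleyEdge α) : (g • e).src = g * e.src := rfl

@[simp] lemma smul_tgt (g : FreeGroup α) (e : CayleyEdge α) : (g • e).tgt = g * e.tgt :=
  mul_assoc _ _ _

/-- Every function on the edges of the Cayley tree is the coboundary of a function on vertices. -/
lemma exists_potential (c : CayleyEdge α → ℚ) :
    ∃ f : FreeGroup α → ℚ, ∀ e : CayleyEdge α, f e.tgt - f e.src = c e := by
  -- A walker carries a vertex and a running sum of `c`. The letter `a` crosses the outgoing edge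
  -- labelled `a`; the opposite group makes words act from the right.
  let P : α → Equiv.Perm (FreeGroup α × ℚ) := fun a =>
    { toFun := fun p => (p.1 * FreeGroup.of a, p.2 + c ⟨p.1, a⟩)
      invFun := fun p => (p.1 * (FreeGroup.of a)⁻¹, p.2 - c ⟨p.1 * (FreeGroup.of a)⁻¹, a⟩)
      left_inv := fun p => by simp
      right_inv := fun p => by simp }
  let ψ : FreeGroup α →* (Equiv.Perm (FreeGroup α × ℚ))ᵐᵒᵖ :=
    FreeGroup.lift fun a => MulOpposite.op (P a)
  have hof : ∀ a, (ψ (FreeGroup.of a)).unop = P a := fun a => by simp [ψ]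
  have hmul : ∀ x y p, (ψ (x * y)).unop p = (ψ y).unop ((ψ x).unop p) := fun x y p => by
    rw [map_mul, MulOpposite.unop_mul, Equiv.Perm.mul_apply]
  have hfst : ∀ x p, ((ψ x).unop p).1 = p.1 * x := by
    intro x
    induction x using FreeGroup.induction_on with
    | C1 => intro p; simp
    | of a => intro p; rw [hof]; rfl
    | inv_of a _ =>
      intro p
      rw [map_inv, MulOpposite.unop_inv, hof]
      rfl
    | mul x y hx hy => intro p; rw [hmul, hy, hx, mul_assoc]
  refine ⟨fun x => ((ψ x).unop (1, 0)).2, fun e => ?_⟩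
  simp only [tgt]
  rw [hmul, hof]
  change ((ψ e.src).unop (1, 0)).2 + c ⟨((ψ e.src).unop (1, 0)).1, e.lab⟩ - _ = _
  rw [hfst, one_mul]
  ring

end CayleyEdge

namespace FreeGroup

variable {α : Type*}

/-- A set of vertices of the Cayley tree is connected if functions on it that are constant along
edges are constant. -/
def TreeConnected (X : Set (FreeGroup α)) : Prop :=
  ∀ u : FreeGroup α → ℚ, (∀ e : CayleyEdge α, e.src ∈ X → e.tgt ∈ X → u e.tgt = u e.src) →
    ∀ x ∈ X, ∀ y ∈ X, u x = u y

/-- Subtrees of the Cayley tree intersect in subtrees. -/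
lemma TreeConnected.inter {X Y : Set (FreeGroup α)} (hX : TreeConnected X) (hY : TreeConnected Y) :
    TreeConnected (X ∩ Y) := by
  classical
  intro u hu x hx y hy
  let w : FreeGroup α → ℚ := fun z => if z ∈ X ∩ Y then u z else 0
  -- On `X` the potential `f` differs from `w` by a constant. On `Y` it is constant, because edges
  -- of `Y` within `X` lie in `X ∩ Y`, where `u` does not change.
  obtain ⟨f, hf⟩ := CayleyEdge.exists_potential fun e =>
    if e.src ∈ X ∧ e.tgt ∈ X then w e.tgt - w e.src else 0
  have hfX := hX (fun z => f z - w z) (fun e hs ht => by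
    have := hf e
    rw [if_pos ⟨hs, ht⟩] at this
    linarith) x hx.1 y hy.1
  have hfY := hY f (fun e hs ht => by
    have := hf e
    split_ifs at this with h
    · rw [show w e.tgt = u e.tgt from if_pos ⟨h.2, ht⟩,
        show w e.src = u e.src from if_pos ⟨h.1, hs⟩,
        hu e ⟨h.1, hs⟩ ⟨h.2, ht⟩] at this
      linarith
    · linarith) x hx.2 y hy.2
  have hwx : w x = u x := if_pos hx
  have hwy : w y = u y := if_pos hy
  linarith

lemma TreeConnected.union {X Y : Set (FreeGroup α)} (hX : TreeConnected X) (hY : TreeConnected Y)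
    {z : FreeGroup α} (hzX : z ∈ X) (hzY : z ∈ Y) : TreeConnected (X ∪ Y) := by
  intro u hu
  have h : ∀ x ∈ X ∪ Y, u x = u z := by
    rintro x (hx | hx)
    · exact hX u (fun e hs ht => hu e (Or.inl hs) (Or.inl ht)) x hx z hzX
    · exact hY u (fun e hs ht => hu e (Or.inr hs) (Or.inr ht)) x hx z hzY
  exact fun x hx y hy => (h x hx).trans (h y hy).symm

lemma TreeConnected.translate {X : Set (FreeGroup α)} (hX : TreeConnected X) (g : FreeGroup α) :
    TreeConnected ((g * ·) '' X) := by
  rintro u hu _ ⟨x, hx, rfl⟩ _ ⟨y, hy, rfl⟩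
  refine hX (fun z => u (g * z)) (fun e hs ht => ?_) x hx y hy
  have := hu (g • e) ⟨_, hs, rfl⟩ ⟨_, ht, (CayleyEdge.smul_tgt g e).symm⟩
  rwa [CayleyEdge.smul_tgt, CayleyEdge.smul_src] at this

lemma treeConnected_edge (e : CayleyEdge α) : TreeConnected {e.src, e.tgt} := by
  intro u hu
  have h := hu e (Or.inl rfl) (Or.inr rfl)
  rintro x (rfl | rfl) y (rfl | rfl) <;> simp [h]

lemma exists_finite_treeConnected (g : FreeGroup α) :
    ∃ P : Set (FreeGroup α), P.Finite ∧ TreeConnected P ∧ 1 ∈ P ∧ g ∈ P := by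
  induction g using FreeGroup.induction_on with
  | C1 =>
    refine ⟨{1}, Set.finite_singleton _, ?_, rfl, rfl⟩
    rintro u - _ rfl _ rfl; rfl
  | of a =>
    exact ⟨_, Set.toFinite _, treeConnected_edge ⟨1, a⟩, Or.inl rfl, Or.inr (one_mul _).symm⟩
  | inv_of a _ =>
    exact ⟨_, Set.toFinite _, treeConnected_edge ⟨(FreeGroup.of a)⁻¹, a⟩,
      Or.inr (inv_mul_cancel _).symm, Or.inl rfl⟩
  | mul x y hx hy =>
    obtain ⟨P, hPf, hP, h1P, hxP⟩ := hx
    obtain ⟨Q, hQf, hQ, h1Q, hyQ⟩ := hy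
    exact ⟨P ∪ (x * ·) '' Q, hPf.union (hQf.image _),
      hP.union (hQ.translate x) hxP ⟨1, h1Q, mul_one x⟩, Or.inl h1P, Or.inr ⟨y, hyQ, rfl⟩⟩

lemma exists_finite_treeConnected_superset (S : Finset (FreeGroup α)) :
    ∃ P : Set (FreeGroup α), P.Finite ∧ TreeConnected P ∧ 1 ∈ P ∧ ↑S ⊆ P := by
  classical
  induction S using Finset.induction_on with
  | empty =>
    obtain ⟨P, hf, hP, h1, -⟩ := exists_finite_treeConnected (1 : FreeGroup α)
    exact ⟨P, hf, hP, h1, by simp⟩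
  | insert g S _ ih =>
    obtain ⟨P, hPf, hP, h1P, hSP⟩ := ih
    obtain ⟨Q, hQf, hQ, h1Q, hgQ⟩ := exists_finite_treeConnected g
    refine ⟨P ∪ Q, hPf.union hQf, hP.union hQ h1P h1Q, Or.inl h1P, ?_⟩
    rw [Finset.coe_insert, Set.insert_subset_iff]
    exact ⟨Or.inr hgQ, hSP.trans Set.subset_union_left⟩

/-- A finitely generated subgroup acts cocompactly on some subtree of the Cayley tree. -/
lemma exists_cocompact_subtree (H : Subgroup (FreeGroup α)) [Group.FG H] :
    ∃ X : SubMulAction H (FreeGroup α), (1 : FreeGroup α) ∈ X ∧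
      TreeConnected (X : Set (FreeGroup α)) ∧ Finite (orbitRel.Quotient H X) := by
  obtain ⟨S, hS⟩ := (Group.fg_iff_subgroup_fg H).1 ‹_›
  obtain ⟨P, hPf, hP, h1P, hSP⟩ := exists_finite_treeConnected_superset S
  -- Translates of a finite subtree containing `1` and the generators: `h * s` lies in both `h P`
  -- and `(h * s) P`, which chains the translates together.
  let X : SubMulAction H (FreeGroup α) :=
    { carrier := {x | ∃ h : H, ∃ p ∈ P, (h : FreeGroup α) * p = x}
      smul_mem' := by
        rintro g _ ⟨h, p, hp, rfl⟩
        exact ⟨g * h, p, hp, mul_assoc _ _ _⟩ }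
  have hX : ∀ (h : H), ∀ p ∈ P, (h : FreeGroup α) * p ∈ X := fun h p hp => ⟨h, p, hp, rfl⟩
  refine ⟨X, ⟨1, 1, h1P, one_mul _⟩, ?_, ?_⟩
  · intro u hu
    have htrans : ∀ h ∈ H, ∀ p ∈ P, u (h * p) = u h := fun h hh p hp => by
      have := hP.translate h u (fun e hs ht => hu e ?_ ?_) (h * p) ⟨p, hp, rfl⟩
        (h * 1) ⟨1, h1P, rfl⟩
      · rwa [mul_one] at this
      · obtain ⟨q, hq, hqe⟩ := hs; exact hqe ▸ hX ⟨h, hh⟩ q hq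
      · obtain ⟨q, hq, hqe⟩ := ht; exact hqe ▸ hX ⟨h, hh⟩ q hq
    have hH : ∀ h ∈ H, u h = u 1 := by
      intro h hh
      rw [← hS] at hh
      induction hh using Subgroup.closure_induction_right with
      | one => rfl
      | mul_right x hx y hy ih => rw [htrans x (hS ▸ hx) y (hSP hy), ih]
      | mul_inv_cancel x hx y hy ih =>
        have hy' : y ∈ H := hS ▸ Subgroup.subset_closure hy
        have := htrans (x * y⁻¹) (H.mul_mem (hS ▸ hx) (H.inv_mem hy')) y (hSP hy)
        rw [inv_mul_cancel_right] at this
        rw [← this, ih]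
    have hall : ∀ x ∈ X, u x = u 1 := by
      rintro _ ⟨h, p, hp, rfl⟩
      rw [htrans h h.2 p hp, hH h h.2]
    exact fun x hx y hy => (hall x hx).trans (hall y hy).symm
  · have := hPf.to_subtype
    refine Finite.of_surjective (fun p : P => Quotient.mk (orbitRel H X)
      ⟨p.1, 1, p.1, p.2, one_mul _⟩) fun q => ?_
    obtain ⟨⟨_, h, p, hp, rfl⟩, rfl⟩ := Quotient.exists_rep q
    exact ⟨⟨p, hp⟩, Quotient.sound ⟨h⁻¹, Subtype.ext (inv_mul_cancel_left _ _)⟩⟩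

end FreeGroup

/-! ### Passing to intersections -/

namespace EdgeOrder

/-- Essential edges of a subgraph are essential. -/
lemma IsEssential.map {V E V' E' : Type*} [LinearOrder E] [LinearOrder E'] {s t : E → V}
    {s' t' : E' → V'} {φ : V → V'} {ψ : E → E'} (hφ : Function.Injective φ) (hψ : StrictMono ψ)
    (hs : ∀ e, s' (ψ e) = φ (s e)) (ht : ∀ e, t' (ψ e) = φ (t e)) {e : E}
    (he : IsEssential s t e) : IsEssential s' t' (ψ e) := by
  have hbelow : ∀ x y, Below s t e x y → Below s' t' (ψ e) (φ x) (φ y) := by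
    intro x y h
    induction h with
    | rel x y h =>
      obtain ⟨d, hd, rfl, rfl⟩ := h
      rw [← hs, ← ht]
      exact Below.of_lt (hψ hd)
    | refl => exact Below.refl _ _
    | symm _ _ _ ih => exact ih.symm
    | trans _ _ _ _ _ ih₁ ih₂ => exact ih₁.trans ih₂
  have hinf : ∀ x, (cluster s t e x).Infinite → (cluster s' t' (ψ e) (φ x)).Infinite := fun x h =>
    (h.image hφ.injOn).mono (by rintro _ ⟨y, hy, rfl⟩; exact hbelow _ _ hy)
  refine ⟨?_, ?_⟩
  · rw [hs]; exact hinf _ he.1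
  · rw [ht]; exact hinf _ he.2

end EdgeOrder

/-- For a free action, orbits of an intersection are determined by a pair of orbits. -/
lemma exists_injective_orbit_map {G T : Type*} [Group G] [MulAction G T]
    (hfree : ∀ (g : G) (x : T), g • x = x → g = 1) {H K : Subgroup G} {X : SubMulAction H T}
    {Y : SubMulAction K T} {Z : SubMulAction (H ⊓ K : Subgroup G) T} (ι : Z → X) (κ : Z → Y)
    (hι : ∀ z, (ι z : T) = z) (hκ : ∀ z, (κ z : T) = z) :
    ∃ f : orbitRel.Quotient (H ⊓ K : Subgroup G) Z →
        orbitRel.Quotient H X × orbitRel.Quotient K Y,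
      Function.Injective f ∧ ∀ z, f (Quotient.mk _ z) =
        (Quotient.mk _ (ι z), Quotient.mk _ (κ z)) := by
  refine ⟨fun q => Quotient.liftOn q
    (fun z => (Quotient.mk (orbitRel H X) (ι z), Quotient.mk (orbitRel K Y) (κ z))) ?_, ?_,
    fun z => rfl⟩
  · rintro _ z ⟨g, rfl⟩
    refine Prod.ext (Quotient.sound ⟨⟨g, g.2.1⟩, Subtype.ext ?_⟩)
      (Quotient.sound ⟨⟨g, g.2.2⟩, Subtype.ext ?_⟩)
    · rw [hι]; exact congrArg ((g : G) • ·) (hι z)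
    · rw [hκ]; exact congrArg ((g : G) • ·) (hκ z)
  · intro p q
    induction p, q using Quotient.inductionOn₂ with | _ z w =>
    intro h
    obtain ⟨a, ha⟩ : ∃ a : H, a • ι w = ι z := Quotient.exact (congrArg Prod.fst h)
    obtain ⟨b, hb⟩ : ∃ b : K, b • κ w = κ z := Quotient.exact (congrArg Prod.snd h)
    have ha' : (a : G) • (w : T) = z := by rw [← hι, ← hι z, ← ha]; rfl
    have hb' : (b : G) • (w : T) = z := by rw [← hκ, ← hκ z, ← hb]; rfl
    -- Both elements carry `w` to `z`, so freeness makes them a single element of `H ⊓ K`.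
    have hab : (a : G) = b := by
      have := hfree ((b : G)⁻¹ * a) (w : T) (by rw [mul_smul, ha', ← hb', inv_smul_smul])
      exact (inv_mul_eq_one.1 this).symm
    exact Quotient.sound ⟨⟨a, a.2, hab ▸ b.2⟩, Subtype.ext ha'⟩

/-! ### Essential edges of invariant subtrees and the rank inequality -/

namespace FreeGroup

variable {α : Type*} {H : Subgroup (FreeGroup α)} (X : SubMulAction H (FreeGroup α))

/-- The edges of the Cayley tree spanned by an invariant set of vertices. -/
def spannedEdges : SubMulAction H (CayleyEdge α) where
  carrier := {e | e.src ∈ X ∧ e.tgt ∈ X}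
  smul_mem' g e he :=
    ⟨X.smul_mem g he.1, (CayleyEdge.smul_tgt (g : FreeGroup α) e).symm ▸ X.smul_mem g he.2⟩

def spannedSrc (e : spannedEdges X) : X := ⟨e.1.src, e.2.1⟩

def spannedTgt (e : spannedEdges X) : X := ⟨e.1.tgt, e.2.2⟩

/-- The number of orbits of essential edges. -/
noncomputable def essentialCount [LinearOrder (CayleyEdge α)] : ℕ :=
  ((Quotient.mk (orbitRel H (spannedEdges X))) ''
    {e | IsEssential (spannedSrc X) (spannedTgt X) e}).ncard

variable {X}

lemma spannedSrc_smul (g : H) (e : spannedEdges X) : spannedSrc X (g • e) = g • spannedSrc X e :=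
  rfl

lemma spannedTgt_smul (g : H) (e : spannedEdges X) : spannedTgt X (g • e) = g • spannedTgt X e :=
  Subtype.ext (CayleyEdge.smul_tgt _ _)

lemma spanned_free (g : H) (x : X) (h : g • x = x) : g = 1 :=
  Subtype.ext (mul_eq_right.1 (congrArg Subtype.val h))

lemma spanned_potential (c : spannedEdges X → ℚ) :
    ∃ f : X → ℚ, ∀ e, f (spannedTgt X e) - f (spannedSrc X e) = c e := by
  classical
  obtain ⟨f, hf⟩ := CayleyEdge.exists_potential fun e =>
    if h : e ∈ spannedEdges X then c ⟨e, h⟩ else 0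
  refine ⟨fun x => f x, fun e => (hf e).trans ?_⟩
  rw [dif_pos e.2]

lemma spanned_connected (hX : TreeConnected (X : Set (FreeGroup α))) (f : X → ℚ)
    (hf : ∀ e, f (spannedTgt X e) = f (spannedSrc X e)) (x y : X) : f x = f y := by
  classical
  have := hX (fun z => if h : z ∈ X then f ⟨z, h⟩ else 0) (fun e hs ht => by
    have hs' : e.src ∈ X := hs
    have ht' : e.tgt ∈ X := ht
    rw [dif_pos hs', dif_pos ht']
    exact hf ⟨e, hs, ht⟩) x x.2 y y.2
  simpa using this

lemma finite_spannedEdges_quotient [Finite α] [Finite (orbitRel.Quotient H X)] :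
    Finite (orbitRel.Quotient H (spannedEdges X)) := by
  let f : orbitRel.Quotient H (spannedEdges X) → orbitRel.Quotient H X × α := fun q =>
    Quotient.liftOn q (fun e => (Quotient.mk (orbitRel H X) (spannedSrc X e), e.1.lab)) (by
      rintro _ e ⟨g, rfl⟩
      exact Prod.ext (Quotient.sound ⟨g, rfl⟩) rfl)
  refine Finite.of_injective f fun p q => ?_
  induction p, q using Quotient.inductionOn₂ with | _ d e =>
  intro h
  obtain ⟨g, hg⟩ : ∃ g : H, g • spannedSrc X e = spannedSrc X d :=
    Quotient.exact (congrArg Prod.fst h)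
  exact Quotient.sound ⟨g, Subtype.ext (CayleyEdge.ext (congrArg Subtype.val hg)
    (congrArg Prod.snd h).symm)⟩

lemma spanned_locally_finite [Finite α] (x : X) :
    {e | spannedSrc X e = x ∨ spannedTgt X e = x}.Finite := by
  refine Set.Finite.union (s := {e | spannedSrc X e = x}) (t := {e | spannedTgt X e = x})
    (Set.Finite.of_injOn (f := fun e : spannedEdges X => e.1.lab) (t := Set.univ)
      (fun _ _ => Set.mem_univ _) ?_ Set.finite_univ)
    (Set.Finite.of_injOn (f := fun e : spannedEdges X => e.1.lab) (t := Set.univ)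
      (fun _ _ => Set.mem_univ _) ?_ Set.finite_univ)
  · intro d hd e he h
    have hde : spannedSrc X d = spannedSrc X e := Eq.trans hd (Eq.symm he)
    exact Subtype.ext (CayleyEdge.ext (congrArg Subtype.val hde) h)
  · intro d hd e he h
    have hde : spannedTgt X d = spannedTgt X e := Eq.trans hd (Eq.symm he)
    have hde' : d.1.src * FreeGroup.of d.1.lab = e.1.src * FreeGroup.of e.1.lab :=
      congrArg Subtype.val hde
    have h' : d.1.lab = e.1.lab := h
    rw [h'] at hde'
    exact Subtype.ext (CayleyEdge.ext (mul_right_cancel hde') h)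

lemma infinite_of_ne_bot (hH : H ≠ ⊥) : Infinite H := by
  obtain ⟨g, hg⟩ := Subgroup.ne_bot_iff_exists_ne_one.1 hH
  exact Infinite.of_injective (fun n : ℕ => g ^ n) (injective_pow_iff_not_isOfFinOrder.2
    (not_isOfFinOrder_of_isMulTorsionFree hg))

section Ordered

variable [LinearOrder (FreeGroup α)] [LinearOrder (CayleyEdge α)]
  (hV : ∀ g x y : FreeGroup α, x < y → g * x < g * y)
  (hE : ∀ (g : FreeGroup α) (d e : CayleyEdge α), d < e → g • d < g • e)

include hV hE

/-- This half does not need an infinite tree, so it applies to `H ⊓ K` even when that is trivial. -/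
lemma finrank_hom_le_essentialCount [Finite α] [Finite (orbitRel.Quotient H X)] [Nonempty X]
    (hX : TreeConnected (X : Set (FreeGroup α))) :
    Module.Finite ℚ (Additive H →+ ℚ) ∧ finrank ℚ (Additive H →+ ℚ) ≤ essentialCount X + 1 := by
  have := finite_spannedEdges_quotient (X := X)
  obtain ⟨hfin, h⟩ := finrank_hom_add_card (L := H) (V := X) (E := spannedEdges X)
    spanned_free spannedSrc_smul spannedTgt_smul spanned_potential (spanned_connected hX)
  have h' := card_edge_orbits_le (L := H) (V := X) (E := spannedEdges X)
    spannedSrc_smul spannedTgt_smul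
    (fun g d e h => hE g d e h) (fun g x y h => hV g x y h) spanned_potential
  refine ⟨hfin, ?_⟩
  unfold essentialCount
  omega

/-- Nontriviality makes `H`, hence `X`, infinite, as is needed for every vertex to lose. -/
lemma essentialCount_add_one_le_finrank_hom [Finite α] [Finite (orbitRel.Quotient H X)] [Nonempty X]
    (hX : TreeConnected (X : Set (FreeGroup α))) (hH : H ≠ ⊥) :
    essentialCount X + 1 ≤ finrank ℚ (Additive H →+ ℚ) := by
  have := finite_spannedEdges_quotient (X := X)
  have := infinite_of_ne_bot hH
  obtain ⟨x₀⟩ := ‹Nonempty X›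
  have : Infinite X := Infinite.of_injective (fun g : H => g • x₀) fun g h hgh =>
    Subtype.ext (mul_right_cancel (congrArg Subtype.val hgh))
  obtain ⟨-, h⟩ := finrank_hom_add_card (L := H) (V := X) (E := spannedEdges X)
    spanned_free spannedSrc_smul spannedTgt_smul spanned_potential (spanned_connected hX)
  have h' := card_vertex_orbits_add_le (L := H) (V := X) (E := spannedEdges X)
    spannedSrc_smul spannedTgt_smul
    (fun g d e h => hE g d e h) (fun g x y h => hV g x y h) spanned_free (spanned_connected hX)
    spanned_locally_finite
  unfold essentialCount
  omega

end Ordered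

/-- The intersection of invariant sets, as an invariant set for the intersection of the groups. -/
def interSubMulAction {K : Subgroup (FreeGroup α)} (X : SubMulAction H (FreeGroup α))
    (Y : SubMulAction K (FreeGroup α)) :
    SubMulAction (H ⊓ K : Subgroup (FreeGroup α)) (FreeGroup α) where
  carrier := X ∩ Y
  smul_mem' g _ hx := ⟨X.smul_mem ⟨g, g.2.1⟩ hx.1, Y.smul_mem ⟨g, g.2.2⟩ hx.2⟩

lemma finite_inter_quotient {K : Subgroup (FreeGroup α)} (Y : SubMulAction K (FreeGroup α))
    [Finite (orbitRel.Quotient H X)] [Finite (orbitRel.Quotient K Y)] :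
    Finite (orbitRel.Quotient (H ⊓ K : Subgroup (FreeGroup α)) (interSubMulAction X Y)) := by
  obtain ⟨f, hf, -⟩ := exists_injective_orbit_map (Z := interSubMulAction X Y)
    (fun (g x : FreeGroup α) h => mul_eq_right.1 h)
    (fun z => (⟨z, z.2.1⟩ : X)) (fun z => (⟨z, z.2.2⟩ : Y)) (fun _ => rfl) fun _ => rfl
  exact Finite.of_injective f hf

/-- The number of orbits of essential edges is submultiplicative. -/
lemma essentialCount_inter_le [Finite α] [LinearOrder (CayleyEdge α)] {K : Subgroup (FreeGroup α)}
    (Y : SubMulAction K (FreeGroup α)) [Finite (orbitRel.Quotient H X)]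
    [Finite (orbitRel.Quotient K Y)] :
    essentialCount (interSubMulAction X Y) ≤ essentialCount X * essentialCount Y := by
  have := finite_spannedEdges_quotient (X := X)
  have := finite_spannedEdges_quotient (X := Y)
  let ι : spannedEdges (interSubMulAction X Y) → spannedEdges X :=
    fun e => ⟨e, e.2.1.1, e.2.2.1⟩
  let κ : spannedEdges (interSubMulAction X Y) → spannedEdges Y :=
    fun e => ⟨e, e.2.1.2, e.2.2.2⟩
  obtain ⟨f, hf, hfmk⟩ := exists_injective_orbit_map (T := CayleyEdge α)
    (fun (g : FreeGroup α) x h => mul_eq_right.1 (congrArg CayleyEdge.src h))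
    ι κ (fun _ => rfl) fun _ => rfl
  unfold essentialCount
  rw [← Set.ncard_prod]
  refine Set.ncard_le_ncard_of_injOn f ?_ hf.injOn (Set.toFinite _)
  rintro _ ⟨e, he, rfl⟩
  rw [hfmk]
  refine ⟨⟨ι e, ?_, rfl⟩, ⟨κ e, ?_, rfl⟩⟩
  · exact IsEssential.map (s' := spannedSrc X) (t' := spannedTgt X) (ψ := ι)
      (φ := fun z : interSubMulAction X Y => (⟨z, z.2.1⟩ : X))
      (fun _ _ h => Subtype.ext (congrArg (fun z : X => (z : FreeGroup α)) h)) (fun _ _ h => h)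
      (fun _ => rfl) (fun _ => rfl) he
  · exact IsEssential.map (s' := spannedSrc Y) (t' := spannedTgt Y) (ψ := κ)
      (φ := fun z : interSubMulAction X Y => (⟨z, z.2.2⟩ : Y))
      (fun _ _ h => Subtype.ext (congrArg (fun z : Y => (z : FreeGroup α)) h)) (fun _ _ h => h)
      (fun _ => rfl) (fun _ => rfl) he

lemma exists_linearOrder_cayleyEdge [LinearOrder (FreeGroup α)]
    (hV : ∀ g x y : FreeGroup α, x < y → g * x < g * y) :
    ∃ _ : LinearOrder (CayleyEdge α), ∀ (g : FreeGroup α) (d e : CayleyEdge α),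
      d < e → g • d < g • e := by
  classical
  let _ : LinearOrder α := linearOrderOfSTO WellOrderingRel
  -- Translation moves the source and fixes the label, so ordering by source first is invariant.
  let φ : CayleyEdge α → FreeGroup α ×ₗ α := fun e => toLex (e.src, e.lab)
  have hφ : Function.Injective φ := fun d e h =>
    CayleyEdge.ext (congrArg Prod.fst (toLex.injective h)) (congrArg Prod.snd (toLex.injective h))
  refine ⟨LinearOrder.lift' φ hφ, fun g d e (h : φ d < φ e) => ?_⟩
  change φ (g • d) < φ (g • e)
  rw [Prod.Lex.toLex_lt_toLex] at h ⊢
  exact h.imp (hV g _ _) fun h => ⟨congrArg (g * ·) h.1, h.2⟩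

/-- The Hanna Neumann inequality in a free group of finite rank. -/
theorem rank_inf_le [Finite α] (H K : Subgroup (FreeGroup α)) [Group.FG H] [Group.FG K]
    (hH : H ≠ ⊥) (hK : K ≠ ⊥) :
    ∃ _ : Group.FG (H ⊓ K : Subgroup (FreeGroup α)),
      Group.rank (H ⊓ K : Subgroup (FreeGroup α)) ≤
        (Group.rank H - 1) * (Group.rank K - 1) + 1 := by
  obtain ⟨_, hV⟩ := exists_linearOrder_mul_left α
  obtain ⟨_, hE⟩ := exists_linearOrder_cayleyEdge hV
  obtain ⟨X, h1X, hX, _⟩ := exists_cocompact_subtree H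
  obtain ⟨Y, h1Y, hY, _⟩ := exists_cocompact_subtree K
  have : Nonempty X := ⟨⟨1, h1X⟩⟩
  have : Nonempty Y := ⟨⟨1, h1Y⟩⟩
  have : Nonempty (interSubMulAction X Y) := ⟨⟨1, h1X, h1Y⟩⟩
  have := finite_inter_quotient (X := X) Y
  have hHr := (essentialCount_add_one_le_finrank_hom hV hE hX hH).trans finrank_hom_le_rank
  have hKr := (essentialCount_add_one_le_finrank_hom hV hE hY hK).trans finrank_hom_le_rank
  obtain ⟨hfin, hr⟩ := finrank_hom_le_essentialCount (X := interSubMulAction X Y) hV hE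
    (hX.inter hY)
  obtain ⟨hfg, hrank⟩ := rank_le_finrank_hom (L := (H ⊓ K : Subgroup (FreeGroup α)))
  refine ⟨hfg, (hrank.trans hr).trans (Nat.add_le_add_right ?_ 1)⟩
  exact (essentialCount_inter_le Y).trans
    (Nat.mul_le_mul (Nat.le_sub_of_add_le hHr) (Nat.le_sub_of_add_le hKr))

end FreeGroup

/-- A finitely generated free group is free on a finite set. -/
lemma IsFreeGroup.finite_generators (G : Type*) [Group G] [IsFreeGroup G] [Group.FG G] :
    Finite (IsFreeGroup.Generators G) := by
  have hfin : Module.Finite ℚ (Additive G →+ ℚ) := finite_hom_of_fg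
  exact (finite_basis_of_finite_hom (IsFreeGroup.basis G)).1

theorem theorem1p1 {F : Type*} [Group F] [IsFreeGroup F] (H K : Subgroup F)
    [Group.FG H] [Group.FG K] (hH : H ≠ ⊥) (hK : K ≠ ⊥) (h k : ℕ)
    (hh : Group.rank H = h) (hk : Group.rank K = k)
    (hjoin : ((h : ℚ) + (k : ℚ) - 1) / 2 ≤ (Group.rank (H ⊔ K : Subgroup F) : ℚ) - 1) :
    ∃ _ : Group.FG (H ⊓ K : Subgroup F),
      (Group.rank (H ⊓ K : Subgroup F) : ℚ) - 1 ≤ ((h : ℚ) - 1) * ((k : ℚ) - 1) := by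
  -- `F` may have infinite rank, while local finiteness needs a finite basis; the subgroups are
  -- pulled back to the finitely generated free group `H ⊔ K`.
  let J : Subgroup F := H ⊔ K
  have : Finite (IsFreeGroup.Generators J) := IsFreeGroup.finite_generators J
  let φ : FreeGroup (IsFreeGroup.Generators J) →* F :=
    J.subtype.comp (IsFreeGroup.mulEquiv J).toMonoidHom
  have hφ : Function.Injective φ :=
    J.subtype_injective.comp (IsFreeGroup.mulEquiv J).injective
  have hrange : φ.range = J := by
    rw [MonoidHom.range_comp, MonoidHom.range_eq_top.2 (IsFreeGroup.mulEquiv J).surjective,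
      ← MonoidHom.range_eq_map, Subgroup.range_subtype]
  have hmap : ∀ A ≤ J, (A.comap φ).map φ = A := fun A hA =>
    Subgroup.map_comap_eq_self (hrange.symm ▸ hA)
  have equiv : ∀ A ≤ J, Nonempty (A.comap φ ≃* A) := fun A hA =>
    ⟨((A.comap φ).equivMapOfInjective φ hφ).trans (MulEquiv.subgroupCongr (hmap A hA))⟩
  obtain ⟨eH⟩ := equiv H le_sup_left
  obtain ⟨eK⟩ := equiv K le_sup_right
  obtain ⟨eL⟩ := equiv (H ⊓ K) (inf_le_left.trans le_sup_left)
  have hHfg : Group.FG (H.comap φ) := Group.fg_of_surjective (f := eH.symm.toMonoidHom)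
    eH.symm.surjective
  have hKfg : Group.FG (K.comap φ) := Group.fg_of_surjective (f := eK.symm.toMonoidHom)
    eK.symm.surjective
  have hne : ∀ A ≤ J, A ≠ ⊥ → A.comap φ ≠ ⊥ := fun A hA hA' h => hA' (by
    rw [← hmap A hA, h, Subgroup.map_bot])
  obtain ⟨hLfg, hL⟩ := FreeGroup.rank_inf_le (H.comap φ) (K.comap φ) (hne H le_sup_left hH)
    (hne K le_sup_right hK)
  have hLfg' : Group.FG ((H ⊓ K).comap φ) := hLfg
  have hLr : Group.rank ((H ⊓ K).comap φ) = Group.rank (H.comap φ ⊓ K.comap φ : Subgroup _) :=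
    Subgroup.rank_congr (Subgroup.comap_inf H K φ)
  rw [← hLr, Group.rank_congr eH, Group.rank_congr eK, hh, hk] at hL
  have hfg : Group.FG (H ⊓ K : Subgroup F) :=
    Group.fg_of_surjective (f := eL.toMonoidHom) eL.surjective
  refine ⟨hfg, ?_⟩
  have hL' : Group.rank (H ⊓ K : Subgroup F) ≤ (h - 1) * (k - 1) + 1 :=
    (Group.rank_congr eL).symm.le.trans hL
  -- Nontrivial groups have positive rank, so the truncated subtractions are genuine.
  have hh1 : 1 ≤ h := by
    have := (Subgroup.nontrivial_iff_ne_bot H).2 hH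
    exact hh ▸ Group.rank_pos H
  have hk1 : 1 ≤ k := by
    have := (Subgroup.nontrivial_iff_ne_bot K).2 hK
    exact hk ▸ Group.rank_pos K
  have hcast : (Group.rank (H ⊓ K : Subgroup F) : ℚ) ≤
      ((h - 1 : ℕ) : ℚ) * ((k - 1 : ℕ) : ℚ) + 1 := by
    exact_mod_cast hL'
  rw [Nat.cast_sub hh1, Nat.cast_sub hk1, Nat.cast_one] at hcast
  linarith
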